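/- **Setting.** Fix $J>0$ and $\rho>0$. For $N\ge 2$ let $U:\mathbb R^N\to\mathbb R\times\mathbb R^{N-1}$ be an orthogonal map with $(U\phi)_1=N^{-1/2}\sum_{x=1}^N\phi_x$. For $|m|<\sqrt\rho$ and bounded continuous $F:\mathbb R^N\to\mathbb R$ put $$\langle F\rangle_{\mathrm{MC}}^{m,\rho;N}:=\frac1{|\mathbb S^{N-2}|}\int_{\mathbb S^{N-2}}d\Omega\,(F\circ U^{-1})\bigl(m\sqrt N,\sqrt{N(\rho-m^2)}\,\Omega\bigr),$$ the uniform average of $F$ over $\{\phi:\sum_x\phi_x=mN,\ \sum_x\phi_x^2=\rho N\}$ (it does not depend on the choice of $U$). The microcanonical ensemble of the mean-field spherical model (Hamiltonian $H[\phi]=-\frac J{2N}\bigl(\sum_x\phi_x\bigr)^2-h\sum_x\phi_x$) at external field $h=0$, energy density $\varepsilon\in(-J\rho/2,0]$ and particle density $\rho$ is $$\langle F\rangle_{\mathrm{MC}}^{\varepsilon,\rho;N}:=\tfrac12\langle F\rangle_{\mathrm{MC}}^{m_+,\rho;N}+\tfrac12\langle F\rangle_{\mathrm{MC}}^{m_-,\rho;N},\qquad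 m_\pm=\pm\sqrt{-2\varepsilon/J}.$$ The canonical ensemble at $h=0$, inverse temperature $\beta\in\mathbb R$ and particle density $\rho$ is $$\langle F\rangle_{\mathrm C}^{\beta,\rho;N}:=\frac{\int_{-\rho J/2}^0d\varepsilon\,e^{-\beta\varepsilon N}Z(\varepsilon)\langle F\rangle_{\mathrm{MC}}^{\varepsilon,\rho;N}}{\int_{-\rho J/2}^0d\varepsilon\,e^{-\beta\varepsilon N}Z(\varepsilon)},\qquad Z(\varepsilon)=\frac{(\rho+2\varepsilon/J)^{\frac{N-3}2}}{\sqrt{-2\varepsilon/J}}.$$ For $I\subset\{1,\dots,N\}$, $P_I:\mathbb R^N\to\mathbb R^{|I|}$ denotes the projection onto the coordinates in $I$, listed in increasing order. **Theorem.** Let $h=0$ and let $n$ be a fixed natural number. 1. Let $\varepsilon\in(-J\rho/2,0)$ and $\beta:=\dfrac{1/J}{\rho+2\varepsilon/J}$. There are $C$ and $N_0$, depending only on $J,\rho,\varepsilon,n$, such that for all $N\ge N_0$, all $I\subset\{1,\dots,N\}$ with $|I|=n$ and all bounded $f:\mathbb R^n\to\mathbb R$ that are $1$-Lipschitz for the Euclidean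 norm $\|\cdot\|_2$, $$\bigl|\langle f\circ P_I\rangle_{\mathrm{MC}}^{\varepsilon,\rho;N}-\langle f\circ P_I\rangle_{\mathrm C}^{\beta,\rho;N}\bigr|\le C N^{-1/2}.$$ 2. Let $\varepsilon=0$ and let $\beta<\dfrac1{\rho J}$ be arbitrary. There are $C$ and $N_0$, depending only on $J,\rho,\beta,n$, such that for all $N\ge N_0$, all $I\subset\{1,\dots,N\}$ with $|I|=n$ and all bounded $f:\mathbb R^n\to\mathbb R$ that are $1$-Lipschitz for $\|\cdot\|_2$, $$\bigl|\langle f\circ P_I\rangle_{\mathrm{MC}}^{0,\rho;N}-\langle f\circ P_I\rangle_{\mathrm C}^{\beta,\rho;N}\bigr|\le C N^{-1/2}.$$ -/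

import Mathlib

open MeasureTheory

/-- `U : ℝ^N → ℝ × ℝ^(N-1)` is an orthogonal map whose first coordinate is
`N^(-1/2)` times the magnetization `∑ x, φ x`. -/
def IsMagnetizationCoord {N : ℕ}
    (U : EuclideanSpace ℝ (Fin N) ≃ₗᵢ[ℝ] WithLp 2 (ℝ × EuclideanSpace ℝ (Fin (N - 1)))) :
    Prop :=
  ∀ φ : EuclideanSpace ℝ (Fin N), (U φ).fst = 1 / √(N : ℝ) * ∑ x, φ x

/-- Such orthogonal coordinates exist for every `N ≥ 1`. -/
theorem exists_isMagnetizationCoord (N : ℕ) (hN : 1 ≤ N) :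
    ∃ U : EuclideanSpace ℝ (Fin N) ≃ₗᵢ[ℝ] WithLp 2 (ℝ × EuclideanSpace ℝ (Fin (N - 1))),
      IsMagnetizationCoord U := by
  have hN0 : (0 : ℝ) < N := by exact_mod_cast hN
  have hfin : Module.finrank ℝ (EuclideanSpace ℝ (Fin N)) =
      Module.finrank ℝ (WithLp 2 (ℝ × EuclideanSpace ℝ (Fin (N - 1)))) := by
    rw [(WithLp.linearEquiv 2 ℝ (ℝ × EuclideanSpace ℝ (Fin (N - 1)))).finrank_eq]
    simp
    omega
  let V := (stdOrthonormalBasis ℝ (EuclideanSpace ℝ (Fin N))).equiv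
    (stdOrthonormalBasis ℝ (WithLp 2 (ℝ × EuclideanSpace ℝ (Fin (N - 1))))) (finCongr hfin)
  let e : EuclideanSpace ℝ (Fin N) := WithLp.toLp 2 fun _ => 1 / √(N : ℝ)
  let w : WithLp 2 (ℝ × EuclideanSpace ℝ (Fin (N - 1))) := WithLp.toLp 2 (1, 0)
  have he : ‖e‖ = 1 := by
    rw [EuclideanSpace.norm_eq]
    simp [e, hN0.ne']
  have hw : ‖w‖ = 1 := by
    rw [WithLp.prod_norm_eq_of_L2]
    simp [w]
  have hVe : ‖V e‖ = ‖w‖ := by rw [V.norm_map, he, hw]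
  let R := (Submodule.span ℝ {V e - w})ᗮ.reflection
  refine ⟨V.trans R, fun φ => ?_⟩
  have hR : (V.trans R) e = w := Submodule.reflection_sub hVe
  have h1 : inner ℝ w ((V.trans R) φ) = inner ℝ e φ := by
    rw [← hR, LinearIsometryEquiv.inner_map_map]
  rw [WithLp.prod_inner_apply] at h1
  simp only [w, e, PiLp.inner_apply] at h1
  simp at h1
  have h2 : ((V.trans R) φ).fst = ∑ x, φ x * (√(N : ℝ))⁻¹ := h1
  rw [h2, Finset.mul_sum]
  simp [mul_comm]

/-- The projection `P_I : ℝ^N → ℝ^n`, `n = |I|`, listing the coordinates in `I` in increasing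
order. -/
def coordProj {N n : ℕ} (I : Finset (Fin N)) (hI : I.card = n)
    (φ : EuclideanSpace ℝ (Fin N)) : EuclideanSpace ℝ (Fin n) :=
  WithLp.toLp 2 fun j => φ (I.orderEmbOfFin hI j)

noncomputable section

/-- Expectation in the auxiliary microcanonical ensemble (fixed magnetization density `m` and
particle density `ρ`): the average of `f (U⁻¹ (m √N, √(N (ρ - m²)) Ω))` over the surface measure
of the unit sphere of `ℝ^(N-1)`. -/
def magMicrocanonical {N : ℕ}
    (U : EuclideanSpace ℝ (Fin N) ≃ₗᵢ[ℝ] WithLp 2 (ℝ × EuclideanSpace ℝ (Fin (N - 1))))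
    (m ρ : ℝ) (f : EuclideanSpace ℝ (Fin N) → ℝ) : ℝ :=
  let σ := (volume : Measure (EuclideanSpace ℝ (Fin (N - 1)))).toSphere
  (σ.real Set.univ)⁻¹ *
    ∫ Ω, f (U.symm (WithLp.toLp 2
      (m * √(N : ℝ), √((N : ℝ) * (ρ - m ^ 2)) • (Ω : EuclideanSpace ℝ (Fin (N - 1)))))) ∂σ

/-- Specific auxiliary microcanonical partition function. -/
def magPartition (N : ℕ) (m ρ : ℝ) : ℝ := (ρ - m ^ 2) ^ (((N : ℝ) - 3) / 2)

/-- The larger magnetization density of energy density `ε`. -/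
def magPlus (J h ε : ℝ) : ℝ := -(h / J) + √(h ^ 2 / J ^ 2 - 2 * ε / J)

/-- The smaller magnetization density of energy density `ε`. -/
def magMinus (J h ε : ℝ) : ℝ := -(h / J) - √(h ^ 2 / J ^ 2 - 2 * ε / J)

open Classical in
/-- Expectation in the microcanonical ensemble with coupling `J`, external field `h`, energy
density `ε` and particle density `ρ`. The last value `0` is a dummy: there the ensemble is
undefined. -/
def microcanonical {N : ℕ}
    (U : EuclideanSpace ℝ (Fin N) ≃ₗᵢ[ℝ] WithLp 2 (ℝ × EuclideanSpace ℝ (Fin (N - 1))))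
    (J h ε ρ : ℝ) (f : EuclideanSpace ℝ (Fin N) → ℝ) : ℝ :=
  let mp := magPlus J h ε
  let mm := magMinus J h ε
  if ε < h ^ 2 / (2 * J) ∧ mp ^ 2 < ρ ∧ mm ^ 2 < ρ then
    magPartition N mp ρ / (magPartition N mp ρ + magPartition N mm ρ) *
        magMicrocanonical U mp ρ f +
      magPartition N mm ρ / (magPartition N mp ρ + magPartition N mm ρ) *
        magMicrocanonical U mm ρ f
  else if ε < h ^ 2 / (2 * J) ∧ min (mm ^ 2) (mp ^ 2) < ρ then
    magMicrocanonical U (if |mp| < |mm| then mp else mm) ρ f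
  else if ε = h ^ 2 / (2 * J) ∧ h ^ 2 / J ^ 2 < ρ then
    magMicrocanonical U (-(h / J)) ρ f
  else 0

/-- Microcanonical partition function for `h = 0`. -/
def energyPartition (N : ℕ) (J ε ρ : ℝ) : ℝ :=
  (ρ + 2 * ε / J) ^ (((N : ℝ) - 3) / 2) / √(-(2 * ε / J))

/-- Expectation in the canonical ensemble for `h = 0`, with inverse temperature `β` and particle
density `ρ`. -/
def canonical {N : ℕ}
    (U : EuclideanSpace ℝ (Fin N) ≃ₗᵢ[ℝ] WithLp 2 (ℝ × EuclideanSpace ℝ (Fin (N - 1))))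
    (J β ρ : ℝ) (f : EuclideanSpace ℝ (Fin N) → ℝ) : ℝ :=
  (∫ ε in (-(ρ * J / 2))..0, Real.exp (-(β * ε * N)) * energyPartition N J ε ρ)⁻¹ *
    ∫ ε in (-(ρ * J / 2))..0,
      Real.exp (-(β * ε * N)) * energyPartition N J ε ρ * microcanonical U J 0 ε ρ f

end

/-! The substitution ε = -Jm²/2 turns the canonical ensemble into a mixture of the symmetrized
sectors ±m, 0 < m < √ρ, with weight w(m) = exp(βJNm²/2)(ρ - m²)^((N-3)/2). The microcanonical
ensemble is the single sector pair ±a. Two facts then suffice.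

Sector averages of a Lipschitz local observable are Lipschitz in m near a, uniformly in N: each
coordinate on the shell equals m + √(ρ - m²)·√N⟨v, Ω⟩ with ‖v‖ ≤ 1, and √N⟨v, Ω⟩ has second moment
at most N/(N-1) ≤ 2 (`magMicrocanonical_sub_le`).

Under w, the mean of N(m - a)² is bounded. To leading order in N, a maximizes the exponent: a² = ρ -
1/(βJ) in the ordered case, a = 0 when βJρ < 1. The bound needs no Laplace asymptotics: integrating
the derivative of (m - a)(ρ - m²)w(m) gives one inequality (`integral_magWeight_mul_nonneg`), from
which both regimes follow.

Averaging |m - a| against w then gives the rate N^(-1/2). -/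

/-! ### Rotation invariance and second moments on the sphere. -/

section Sphere

/-- The action of a linear isometry on the unit sphere. -/
def sphereMap {E : Type*} [NormedAddCommGroup E] [InnerProductSpace ℝ E] (R : E ≃ₗᵢ[ℝ] E)
    (Ω : Metric.sphere (0 : E) 1) : Metric.sphere (0 : E) 1 :=
  ⟨R Ω, by simp⟩

theorem continuous_sphereMap {E : Type*} [NormedAddCommGroup E] [InnerProductSpace ℝ E]
    (R : E ≃ₗᵢ[ℝ] E) : Continuous (sphereMap R) := by
  unfold sphereMap
  fun_prop

variable {E : Type*} [NormedAddCommGroup E] [InnerProductSpace ℝ E] [FiniteDimensional ℝ E]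
  [MeasurableSpace E] [BorelSpace E]

-- The surface measure of a set is proportional to the volume of the cone over it, so invariance
-- descends from Lebesgue measure.
open scoped Pointwise in
theorem measurePreserving_sphereMap (R : E ≃ₗᵢ[ℝ] E) :
    MeasurePreserving (sphereMap R) (volume : Measure E).toSphere
      (volume : Measure E).toSphere := by
  have hm : Measurable (sphereMap R) := (continuous_sphereMap R).measurable
  refine ⟨hm, ?_⟩
  ext s hs
  rw [Measure.map_apply hm hs, Measure.toSphere_apply' _ (hm hs), Measure.toSphere_apply' _ hs]
  congr 1
  have hR : MeasurePreserving R.toMeasurableEquiv volume volume := R.measurePreserving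
  rw [← hR.measure_preimage_equiv (Set.Ioo (0 : ℝ) 1 • (Subtype.val '' s))]
  congr 1
  ext x
  simp only [Set.mem_smul, Set.mem_image, Set.mem_preimage, Subtype.exists]
  constructor
  · rintro ⟨t, ht, _, ⟨y, hy, hys, rfl⟩, rfl⟩
    exact ⟨t, ht, R y, ⟨R y, by simpa using hy, hys, rfl⟩, (map_smul R t y).symm⟩
  · rintro ⟨t, ht, _, ⟨y, hy, hys, rfl⟩, hx⟩
    change t • y = R x at hx
    refine ⟨t, ht, R.symm y, ⟨R.symm y, by simpa using hy, ?_, rfl⟩, ?_⟩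
    · simpa [sphereMap] using hys
    · apply R.injective
      simpa using hx

theorem Continuous.integrable_toSphere {g : Metric.sphere (0 : E) 1 → ℝ} (hg : Continuous g) :
    Integrable g (volume : Measure E).toSphere := by
  have h := hg.continuousOn.integrableOn_compact (μ := (volume : Measure E).toSphere)
    (isCompact_univ)
  simpa using h

/-- The reflection in the hyperplane orthogonal to v - w exchanges the two vectors and preserves the
surface measure. -/
theorem integral_sq_inner_toSphere_congr {v w : E} (h : ‖v‖ = ‖w‖) :
    ∫ Ω, (inner ℝ v (Ω : E)) ^ 2 ∂(volume : Measure E).toSphere =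
      ∫ Ω, (inner ℝ w (Ω : E)) ^ 2 ∂(volume : Measure E).toSphere := by
  let R := (Submodule.span ℝ {v - w})ᗮ.reflection
  have hR : R v = w := Submodule.reflection_sub h
  have hp := measurePreserving_sphereMap R
  have h1 : ∫ Ω, (inner ℝ w (Ω : E)) ^ 2 ∂(volume : Measure E).toSphere =
      ∫ Ω, (inner ℝ w ((sphereMap R Ω : _) : E)) ^ 2 ∂(volume : Measure E).toSphere := by
    conv_lhs => rw [← hp.map_eq]
    rw [integral_map hp.aemeasurable]
    exact (by fun_prop : Continuous fun Ω : Metric.sphere (0 : E) 1 =>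
      (inner ℝ w (Ω : E)) ^ 2).aestronglyMeasurable
  rw [h1]
  refine integral_congr_ae (.of_forall fun Ω => ?_)
  simp only [sphereMap, ← hR, LinearIsometryEquiv.inner_map_map]

/-- By invariance v may be replaced by ‖v‖ times any basis vector; summing over an orthonormal basis
uses ‖Ω‖ = 1. -/
theorem finrank_mul_integral_sq_inner_toSphere (v : E) :
    (Module.finrank ℝ E : ℝ) * ∫ Ω, (inner ℝ v (Ω : E)) ^ 2 ∂(volume : Measure E).toSphere =
      ‖v‖ ^ 2 * (volume : Measure E).toSphere.real Set.univ := by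
  let b := stdOrthonormalBasis ℝ E
  have h1 : ∀ i, ∫ Ω, (inner ℝ v (Ω : E)) ^ 2 ∂(volume : Measure E).toSphere =
      ∫ Ω, (inner ℝ (‖v‖ • b i) (Ω : E)) ^ 2 ∂(volume : Measure E).toSphere := fun i =>
    integral_sq_inner_toSphere_congr (by simp [norm_smul])
  calc _ = ∑ i, ∫ Ω, (inner ℝ (‖v‖ • b i) (Ω : E)) ^ 2 ∂(volume : Measure E).toSphere := by
        rw [← Finset.sum_congr rfl fun i _ => h1 i]
        simp
    _ = ∫ Ω, ∑ i, (inner ℝ (‖v‖ • b i) (Ω : E)) ^ 2 ∂(volume : Measure E).toSphere := by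
        rw [integral_finsetSum]
        exact fun i _ => Continuous.integrable_toSphere (by fun_prop)
    _ = ∫ Ω, ‖v‖ ^ 2 ∂(volume : Measure E).toSphere := by
        refine integral_congr_ae (.of_forall fun Ω => ?_)
        simp only [inner_smul_left, mul_pow, ← Finset.mul_sum]
        have := b.sum_sq_norm_inner_right (Ω : E)
        simp at this
        simp [this]
    _ = _ := by simp [mul_comm]

end Sphere

/-! ### Concentration of the magnetization weight. -/

/-- The density `exp (b m²) (ρ - m²) ^ p` of the magnetization. -/
noncomputable def magWeight (ρ b p m : ℝ) : ℝ := Real.exp (b * m ^ 2) * (ρ - m ^ 2) ^ p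

theorem continuous_magWeight (ρ b : ℝ) {p : ℝ} (hp : 0 ≤ p) : Continuous (magWeight ρ b p) := by
  unfold magWeight
  exact (by fun_prop : Continuous fun m : ℝ => Real.exp (b * m ^ 2)).mul
    ((by fun_prop : Continuous fun m : ℝ => ρ - m ^ 2).rpow_const fun _ => Or.inr hp)

theorem sq_le_of_mem_Icc_sqrt {ρ m : ℝ} (hρ : 0 ≤ ρ) (hm : m ∈ Set.Icc 0 √ρ) : m ^ 2 ≤ ρ := by
  rw [← Real.sq_sqrt hρ]
  exact pow_le_pow_left₀ hm.1 hm.2 2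

theorem magWeight_nonneg {ρ m : ℝ} (hρ : 0 ≤ ρ) (b p : ℝ) (hm : m ∈ Set.Icc 0 √ρ) :
    0 ≤ magWeight ρ b p m :=
  mul_nonneg (Real.exp_pos _).le (Real.rpow_nonneg (by linarith [sq_le_of_mem_Icc_sqrt hρ hm]) _)

theorem integral_magWeight_pos {ρ : ℝ} (hρ : 0 < ρ) (b : ℝ) {p : ℝ} (hp : 0 ≤ p) :
    0 < ∫ m in (0)..√ρ, magWeight ρ b p m := by
  have hr : 0 < √ρ := Real.sqrt_pos.2 hρ
  refine intervalIntegral.intervalIntegral_pos_of_pos_on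
    ((continuous_magWeight ρ b hp).intervalIntegrable _ _) (fun m hm => ?_) hr
  refine mul_pos (Real.exp_pos _) (Real.rpow_pos_of_pos ?_ _)
  have := mul_self_lt_mul_self hm.1.le hm.2
  rw [Real.mul_self_sqrt hρ.le] at this
  linarith [sq m]

theorem hasDerivAt_magWeight_add_one (ρ b m : ℝ) {p : ℝ} (hp : 0 ≤ p) (hm : m ^ 2 ≤ ρ) :
    HasDerivAt (magWeight ρ b (p + 1))
      (magWeight ρ b p m * (m * (2 * b * (ρ - m ^ 2) - 2 * (p + 1)))) m := by
  have h1 : HasDerivAt (fun m : ℝ => Real.exp (b * m ^ 2))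
      (Real.exp (b * m ^ 2) * (b * (2 * m))) m := by
    simpa using (((hasDerivAt_id m).pow 2).const_mul b).exp
  have h2 : HasDerivAt (fun m : ℝ => (ρ - m ^ 2) ^ (p + 1))
      (-(2 * m) * (p + 1) * (ρ - m ^ 2) ^ p) m := by
    have := (((hasDerivAt_id m).pow 2).const_sub ρ).rpow_const (p := p + 1)
      (Or.inr (by linarith))
    simpa using this
  refine (h1.mul h2).congr_deriv ?_
  rw [Real.rpow_add_one' (by linarith) (by linarith), magWeight]
  ring

/-- The integrand is the derivative of (m - a) times the weight with exponent p + 1. That product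
vanishes at √ρ and is nonpositive at 0 because a ≥ 0, so the boundary terms have the right sign. -/
theorem integral_magWeight_mul_nonneg {ρ : ℝ} (hρ : 0 ≤ ρ) (b : ℝ) {p a : ℝ} (hp : 0 ≤ p)
    (ha : 0 ≤ a) :
    0 ≤ ∫ m in (0)..√ρ, magWeight ρ b p m *
      ((ρ - m ^ 2) + (m - a) * m * (2 * b * (ρ - m ^ 2) - 2 * (p + 1))) := by
  have hc := continuous_magWeight ρ b hp
  have hr : 0 ≤ √ρ := Real.sqrt_nonneg ρ
  have hd : ∀ m ∈ Set.uIcc 0 √ρ, HasDerivAt (fun m => (m - a) * magWeight ρ b (p + 1) m)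
      (magWeight ρ b p m *
        ((ρ - m ^ 2) + (m - a) * m * (2 * b * (ρ - m ^ 2) - 2 * (p + 1)))) m := by
    intro m hm
    rw [Set.uIcc_of_le hr] at hm
    have hm' := sq_le_of_mem_Icc_sqrt hρ hm
    refine (((hasDerivAt_id m).sub_const a).mul
      (hasDerivAt_magWeight_add_one ρ b m hp hm')).congr_deriv ?_
    rw [magWeight, Real.rpow_add_one' (by linarith) (by linarith), magWeight]
    simp only [id]
    ring
  rw [intervalIntegral.integral_eq_sub_of_hasDerivAt hd
    (Continuous.intervalIntegrable (by fun_prop) _ _)]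
  have h0 : magWeight ρ b (p + 1) √ρ = 0 := by
    rw [magWeight, Real.sq_sqrt hρ, sub_self, Real.zero_rpow (by linarith), mul_zero]
  have h1 := mul_nonneg ha (magWeight_nonneg hρ b (p + 1) ⟨le_rfl, hr⟩)
  rw [h0]
  linarith

/-- At supercritical temperature the magnetization fluctuates at scale `N ^ (-1 / 2)` around
`0`. -/
theorem integral_magWeight_mul_sq_le_disordered {ρ β N : ℝ} (hρ : 0 < ρ) (hβ : β * ρ < 1)
    (hN : 3 ≤ N) :
    ∫ m in (0)..√ρ, magWeight ρ (β * N / 2) ((N - 3) / 2) m * (N * m ^ 2) ≤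
      2 * ρ / (1 - max (β * ρ) 0) * ∫ m in (0)..√ρ, magWeight ρ (β * N / 2) ((N - 3) / 2) m := by
  have hp : 0 ≤ (N - 3) / 2 := by linarith
  have hr : 0 ≤ √ρ := Real.sqrt_nonneg ρ
  have hc := continuous_magWeight ρ (β * N / 2) hp
  -- The maximum with 0 covers negative β, where β(ρ - m²) is bounded by 0 but not by βρ.
  set κ := max (β * ρ) 0 with hκ
  have hκ1 : 0 < 1 - κ := sub_pos.2 (max_lt hβ one_pos)
  have hκ0 : 0 ≤ κ := le_max_right _ _
  have hκ2 : β * ρ ≤ κ := le_max_left _ _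
  rw [div_mul_eq_mul_div, le_div_iff₀ hκ1, ← intervalIntegral.integral_mul_const,
    ← intervalIntegral.integral_const_mul, ← sub_nonneg, ← intervalIntegral.integral_sub
    (Continuous.intervalIntegrable (by fun_prop) _ _)
    (Continuous.intervalIntegrable (by fun_prop) _ _)]
  refine (integral_magWeight_mul_nonneg hρ.le (β * N / 2) hp le_rfl).trans
    (intervalIntegral.integral_mono_on hr (Continuous.intervalIntegrable (by fun_prop) _ _)
    (Continuous.intervalIntegrable (by fun_prop) _ _) fun m hm => ?_)
  have hm' := sq_le_of_mem_Icc_sqrt hρ.le hm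
  have hw := magWeight_nonneg hρ.le (β * N / 2) ((N - 3) / 2) hm
  have h1 : β * (ρ - m ^ 2) ≤ κ := by
    rcases le_total 0 β with hb | hb
    · nlinarith [sq_nonneg m]
    · nlinarith
  have h2 : N * m ^ 2 * (β * (ρ - m ^ 2)) ≤ N * m ^ 2 * κ :=
    mul_le_mul_of_nonneg_left h1 (by positivity)
  have h3 := mul_le_mul_of_nonneg_left (a := magWeight ρ (β * N / 2) ((N - 3) / 2) m)
    (b := (ρ - m ^ 2) + (m - 0) * m * (2 * (β * N / 2) * (ρ - m ^ 2) - 2 * ((N - 3) / 2 + 1)))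
    (c := 2 * ρ - N * m ^ 2 * (1 - κ)) (by nlinarith) hw
  linarith

/-- The weight increases up to a. With t = (y² - x²)/(ρ - a²), one has ρ - x² ≤ (ρ - y²)(1 + t) ≤ (ρ
- y²)eᵗ, and the Gaussian factor gains exp(tN/2), which beats exp(t(N-3)/2). -/
theorem magWeight_le_magWeight {ρ a N x y : ℝ} (ha : a ^ 2 < ρ) (hN : 3 ≤ N) (hx : 0 ≤ x)
    (hxy : x ≤ y) (hya : y ≤ a) :
    magWeight ρ (1 / (ρ - a ^ 2) * N / 2) ((N - 3) / 2) x ≤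
      magWeight ρ (1 / (ρ - a ^ 2) * N / 2) ((N - 3) / 2) y := by
  have hu : 0 < ρ - a ^ 2 := sub_pos.2 ha
  have hxy2 : x ^ 2 ≤ y ^ 2 := pow_le_pow_left₀ hx hxy 2
  have hya2 : y ^ 2 ≤ a ^ 2 := pow_le_pow_left₀ (hx.trans hxy) hya 2
  have hp : 0 ≤ (N - 3) / 2 := by linarith
  set t := (y ^ 2 - x ^ 2) / (ρ - a ^ 2) with ht
  have ht0 : 0 ≤ t := div_nonneg (by linarith) hu.le
  have ht1 : t * (ρ - a ^ 2) = y ^ 2 - x ^ 2 := div_mul_cancel₀ _ hu.ne'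
  have h1 : ρ - x ^ 2 ≤ (ρ - y ^ 2) * Real.exp t := by
    have := Real.add_one_le_exp t
    nlinarith
  have h2 : (ρ - x ^ 2) ^ ((N - 3) / 2) ≤
      (ρ - y ^ 2) ^ ((N - 3) / 2) * Real.exp (t * ((N - 3) / 2)) := by
    rw [Real.exp_mul, ← Real.mul_rpow (by linarith) (Real.exp_pos _).le]
    exact Real.rpow_le_rpow (by linarith) h1 hp
  have h3 : Real.exp (t * ((N - 3) / 2)) ≤ Real.exp (t * (N / 2)) :=
    Real.exp_le_exp.2 (mul_le_mul_of_nonneg_left (by linarith) ht0)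
  have h4 : 1 / (ρ - a ^ 2) * N / 2 * y ^ 2 =
      1 / (ρ - a ^ 2) * N / 2 * x ^ 2 + t * (N / 2) := by
    rw [ht]
    ring
  rw [magWeight, magWeight, h4, Real.exp_add, mul_assoc]
  refine mul_le_mul_of_nonneg_left (h2.trans ?_) (Real.exp_pos _).le
  rw [mul_comm]
  exact mul_le_mul_of_nonneg_right h3 (Real.rpow_nonneg (by linarith) _)

/-- For this inverse temperature the drift term is proportional to a² - m², so integration by parts
produces N·m·(m - a)²·(m + a). The extra factor m, degenerate at 0, is removed separately in the
ordered estimate. -/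
theorem integral_magWeight_mul_mul_sq_le {ρ a N : ℝ} (hρ : 0 < ρ) (ha0 : 0 < a) (ha : a ^ 2 < ρ)
    (hN : 3 ≤ N) :
    ∫ m in (0)..√ρ, magWeight ρ (1 / (ρ - a ^ 2) * N / 2) ((N - 3) / 2) m *
        (N * m * (m - a) ^ 2) ≤
      ρ * (ρ - a ^ 2) / a *
        ∫ m in (0)..√ρ, magWeight ρ (1 / (ρ - a ^ 2) * N / 2) ((N - 3) / 2) m := by
  have hu : 0 < ρ - a ^ 2 := sub_pos.2 ha
  have hp : 0 ≤ (N - 3) / 2 := by linarith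
  have hr : 0 ≤ √ρ := Real.sqrt_nonneg ρ
  have hc := continuous_magWeight ρ (1 / (ρ - a ^ 2) * N / 2) hp
  rw [← intervalIntegral.integral_const_mul, ← sub_nonneg, ← intervalIntegral.integral_sub
    (Continuous.intervalIntegrable (by fun_prop) _ _)
    (Continuous.intervalIntegrable (by fun_prop) _ _)]
  have h0 := mul_nonneg (div_pos hu ha0).le
    (integral_magWeight_mul_nonneg hρ.le (1 / (ρ - a ^ 2) * N / 2) hp ha0.le)
  refine h0.trans ?_
  rw [← intervalIntegral.integral_const_mul]
  refine intervalIntegral.integral_mono_on hr (Continuous.intervalIntegrable (by fun_prop) _ _)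
    (Continuous.intervalIntegrable (by fun_prop) _ _) fun m hm => ?_
  have hw := magWeight_nonneg hρ.le (1 / (ρ - a ^ 2) * N / 2) ((N - 3) / 2) hm
  have hm0 := hm.1
  have h1 : (ρ - a ^ 2) / a * ((ρ - m ^ 2) + (m - a) * m *
      (2 * (1 / (ρ - a ^ 2) * N / 2) * (ρ - m ^ 2) - 2 * ((N - 3) / 2 + 1))) =
      ρ * (ρ - a ^ 2) / a - (ρ - a ^ 2) * m - N * m * (m - a) ^ 2 * ((m + a) / a) := by
    field_simp
    ring
  have h2 : 1 ≤ (m + a) / a := (one_le_div ha0).2 (by linarith)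
  have h3 : N * m * (m - a) ^ 2 ≤ N * m * (m - a) ^ 2 * ((m + a) / a) :=
    le_mul_of_one_le_right (by positivity) h2
  have h4 := mul_le_mul_of_nonneg_left (a := magWeight ρ (1 / (ρ - a ^ 2) * N / 2) ((N - 3) / 2) m)
    (b := ρ * (ρ - a ^ 2) / a - (ρ - a ^ 2) * m - N * m * (m - a) ^ 2 * ((m + a) / a))
    (c := ρ * (ρ - a ^ 2) / a - N * m * (m - a) ^ 2) (by nlinarith) hw
  rw [← h1] at h4
  linarith

/-- Below the critical energy the modulus of the magnetization fluctuates at scale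
`N ^ (-1 / 2)` around its most likely value `a`. -/
theorem integral_magWeight_mul_sq_le_ordered {ρ a N : ℝ} (hρ : 0 < ρ) (ha0 : 0 < a)
    (ha : a ^ 2 < ρ) (hN : 3 ≤ N) :
    ∫ m in (0)..√ρ, magWeight ρ (1 / (ρ - a ^ 2) * N / 2) ((N - 3) / 2) m * (N * (m - a) ^ 2) ≤
      16 / a * (ρ * (ρ - a ^ 2) / a) *
        ∫ m in (0)..√ρ, magWeight ρ (1 / (ρ - a ^ 2) * N / 2) ((N - 3) / 2) m := by
  have hp : 0 ≤ (N - 3) / 2 := by linarith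
  have har : a / 2 ≤ √ρ := by linarith [Real.le_sqrt_of_sq_le ha.le]
  have hN0 : 0 < N := by linarith
  set w := magWeight ρ (1 / (ρ - a ^ 2) * N / 2) ((N - 3) / 2) with hwdef
  have hc : Continuous w := continuous_magWeight ρ _ hp
  have hw : ∀ m ∈ Set.Icc 0 √ρ, 0 ≤ w m := fun m hm => magWeight_nonneg hρ.le _ _ hm
  have hK := mul_le_mul_of_nonneg_left (integral_magWeight_mul_mul_sq_le hρ ha0 ha hN)
    (by positivity : 0 ≤ 16 / a)
  rw [← hwdef] at hK
  rw [mul_assoc]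
  refine le_trans ?_ hK
  rw [← intervalIntegral.integral_const_mul]
  rw [← intervalIntegral.integral_add_adjacent_intervals (a := 0) (b := a / 2) (c := √ρ)
      (Continuous.intervalIntegrable (by fun_prop) _ _)
      (Continuous.intervalIntegrable (by fun_prop) _ _),
    ← intervalIntegral.integral_add_adjacent_intervals (a := 0) (b := a / 2) (c := √ρ)
      (f := fun m => 16 / a * (w m * (N * m * (m - a) ^ 2)))
      (Continuous.intervalIntegrable (by fun_prop) _ _)
      (Continuous.intervalIntegrable (by fun_prop) _ _)]
  refine add_le_add ?_ ?_
  -- On [0, a/2] the factor m is no longer bounded below. Since w increases there, Chebyshev's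
  -- correlation inequality against a/4 - m, which has mean zero, shows that the w-average of m is
  -- at least a/4. Then N(m - a)² ≤ Na² = 4Na(a/4 - m) + 4Nam, and the last term is controlled using
  -- (m - a)² ≥ a²/4.
  · have h0 : ∫ m in (0)..(a / 2), w (a / 4) * (4 * N * a * (a / 4 - m)) = 0 := by
      have : ∀ m, w (a / 4) * (4 * N * a * (a / 4 - m)) =
        (w (a / 4) * (4 * N * a)) * (a / 4 - m) := fun m => by ring
      simp only [this]
      rw [intervalIntegral.integral_const_mul, intervalIntegral.integral_sub (by simp) (by simp)]
      simp
      right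
      ring
    refine le_of_le_of_eq ?_ ((congrArg _ h0).trans (add_zero _))
    rw [← intervalIntegral.integral_add
      (Continuous.intervalIntegrable (by fun_prop) _ _)
      (Continuous.intervalIntegrable (by fun_prop) _ _)]
    refine intervalIntegral.integral_mono_on (by linarith)
      (Continuous.intervalIntegrable (by fun_prop) _ _)
      (Continuous.intervalIntegrable (by fun_prop) _ _) fun m hm => ?_
    have hwm := hw m ⟨hm.1, hm.2.trans har⟩
    have h1 : (w m - w (a / 4)) * (a / 4 - m) ≤ 0 := by
      rcases le_total m (a / 4) with h | h
      · exact mul_nonpos_of_nonpos_of_nonneg (sub_nonpos.2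
          (magWeight_le_magWeight ha hN hm.1 h (by linarith))) (by linarith)
      · exact mul_nonpos_of_nonneg_of_nonpos (sub_nonneg.2
          (magWeight_le_magWeight ha hN (by linarith) h (by linarith [hm.2]))) (by linarith)
    have h2 := mul_le_mul_of_nonneg_left h1 (by positivity : 0 ≤ 4 * N * a)
    have h3 : a ^ 2 / 4 ≤ (m - a) ^ 2 := by nlinarith [hm.1, hm.2]
    have h3' : (m - a) ^ 2 ≤ a ^ 2 := by nlinarith [hm.1, hm.2]
    have h4 : 4 * N * a * m ≤ 16 / a * (N * m * (m - a) ^ 2) := by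
      calc 4 * N * a * m = 16 / a * (N * m * (a ^ 2 / 4)) := by field_simp; ring
        _ ≤ _ := by
          have := hm.1
          gcongr
    have h5 := mul_le_mul_of_nonneg_left h4 hwm
    have h6 := mul_le_mul_of_nonneg_left (mul_le_mul_of_nonneg_left h3' hN0.le) hwm
    linarith
  · refine intervalIntegral.integral_mono_on har
      (Continuous.intervalIntegrable (by fun_prop) _ _)
      (Continuous.intervalIntegrable (by fun_prop) _ _) fun m hm => ?_
    have hm0 : 0 ≤ m := by linarith [hm.1]
    have hwm := hw m ⟨hm0, hm.2⟩
    have h1 : 1 ≤ 16 / a * m := by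
      rw [div_mul_eq_mul_div, le_div_iff₀ ha0]
      linarith [hm.1]
    have h2 := mul_le_mul_of_nonneg_left (le_mul_of_one_le_right
      (by positivity : 0 ≤ N * (m - a) ^ 2) h1) hwm
    linarith

/-! ### Lipschitz dependence of sector averages on the magnetization. -/

theorem EuclideanSpace.norm_le_sum_abs {ι : Type*} [Fintype ι] (v : EuclideanSpace ℝ ι) :
    ‖v‖ ≤ ∑ i, |v i| := by
  rw [EuclideanSpace.norm_eq]
  refine Real.sqrt_le_iff.2 ⟨Finset.sum_nonneg fun i _ => abs_nonneg _, ?_⟩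
  exact Finset.sum_sq_le_sq_sum_of_nonneg fun i _ => abs_nonneg _

theorem symm_apply_eq_of_isMagnetizationCoord {N : ℕ}
    {U : EuclideanSpace ℝ (Fin N) ≃ₗᵢ[ℝ] WithLp 2 (ℝ × EuclideanSpace ℝ (Fin (N - 1)))}
    (hU : IsMagnetizationCoord U) (y : WithLp 2 (ℝ × EuclideanSpace ℝ (Fin (N - 1))))
    (x : Fin N) :
    U.symm y x = 1 / √(N : ℝ) * y.fst +
      inner ℝ (U (EuclideanSpace.single x 1)).snd y.snd := by
  have h1 : U.symm y x = inner ℝ (EuclideanSpace.single x (1 : ℝ)) (U.symm y) := by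
    simp [EuclideanSpace.inner_single_left]
  rw [h1, ← U.inner_map_map, U.apply_symm_apply, WithLp.prod_inner_apply]
  have h2 : (U (EuclideanSpace.single x 1)).fst = 1 / √(N : ℝ) := by
    rw [hU]
    simp
  change inner ℝ (U (EuclideanSpace.single x 1)).fst y.fst + _ = _
  rw [h2]
  simp [mul_comm]

theorem norm_snd_le_norm {E F : Type*} [SeminormedAddCommGroup E] [SeminormedAddCommGroup F]
    (y : WithLp 2 (E × F)) : ‖y.snd‖ ≤ ‖y‖ := by
  rw [WithLp.prod_norm_eq_of_L2]
  exact Real.le_sqrt_of_sq_le (by linarith [sq_nonneg ‖y.fst‖])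

/-- Both sectors are coupled through the same Ω, so only the second moment of each √N⟨v, Ω⟩ enters.
No restriction on m is needed because `Real.sqrt` vanishes on negative numbers; this also yields
continuity on the whole line. -/
theorem magMicrocanonical_sub_le {N n : ℕ} (hN : 2 ≤ N)
    {U : EuclideanSpace ℝ (Fin N) ≃ₗᵢ[ℝ] WithLp 2 (ℝ × EuclideanSpace ℝ (Fin (N - 1)))}
    (hU : IsMagnetizationCoord U) (I : Finset (Fin N)) (hI : I.card = n)
    {f : EuclideanSpace ℝ (Fin n) → ℝ} (hf : LipschitzWith 1 f) (ρ m m' : ℝ) :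
    |magMicrocanonical U m ρ (f ∘ coordProj I hI) -
        magMicrocanonical U m' ρ (f ∘ coordProj I hI)| ≤
      n * (|m - m'| + 2 * |√(ρ - m ^ 2) - √(ρ - m' ^ 2)|) := by
  set σ := (volume : Measure (EuclideanSpace ℝ (Fin (N - 1)))).toSphere with hσ
  have hN0 : (2 : ℝ) ≤ N := by exact_mod_cast hN
  have hd : ((N - 1 : ℕ) : ℝ) = N - 1 := by
    rw [Nat.cast_sub (by omega), Nat.cast_one]
  have : Nontrivial (EuclideanSpace ℝ (Fin (N - 1))) := by
    have : Nonempty (Fin (N - 1)) := ⟨⟨0, by omega⟩⟩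
    infer_instance
  have hσ0 : 0 < σ.real Set.univ := by
    rw [measureReal_def, ENNReal.toReal_pos_iff]
    exact ⟨Measure.measure_univ_pos.2 (Measure.toSphere_ne_zero _), measure_lt_top _ _⟩
  set v : Fin n → EuclideanSpace ℝ (Fin (N - 1)) := fun j =>
    (U (EuclideanSpace.single (I.orderEmbOfFin hI j) 1)).snd with hv
  have hv1 : ∀ j, ‖v j‖ ^ 2 ≤ 1 := fun j => by
    have h := norm_snd_le_norm (U (EuclideanSpace.single (I.orderEmbOfFin hI j) 1))
    rw [U.norm_map, PiLp.norm_single, norm_one] at h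
    exact pow_le_one₀ (norm_nonneg _) h
  set Φ : ℝ → Metric.sphere (0 : EuclideanSpace ℝ (Fin (N - 1))) 1 → EuclideanSpace ℝ (Fin n) :=
    fun m Ω => coordProj I hI (U.symm (WithLp.toLp 2
      (m * √(N : ℝ), √((N : ℝ) * (ρ - m ^ 2)) • (Ω : EuclideanSpace ℝ (Fin (N - 1)))))) with hΦ
  have hΦj : ∀ m Ω j, Φ m Ω j = m + √(ρ - m ^ 2) * (√N * inner ℝ (v j) (Ω : _)) := by
    intro m Ω j
    have h := symm_apply_eq_of_isMagnetizationCoord hU (WithLp.toLp 2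
      (m * √(N : ℝ), √((N : ℝ) * (ρ - m ^ 2)) • (Ω : EuclideanSpace ℝ (Fin (N - 1)))))
      (I.orderEmbOfFin hI j)
    refine h.trans ?_
    change 1 / √(N : ℝ) * (m * √N) + inner ℝ (v j)
      (√((N : ℝ) * (ρ - m ^ 2)) • (Ω : EuclideanSpace ℝ (Fin (N - 1)))) = _
    rw [inner_smul_right, Real.sqrt_mul (by linarith)]
    have : √(N : ℝ) ≠ 0 := (Real.sqrt_pos.2 (by linarith)).ne'
    field_simp
  have hΦc : ∀ m, Continuous (Φ m) := fun m => by
    have h : Φ m = fun Ω : Metric.sphere (0 : EuclideanSpace ℝ (Fin (N - 1))) 1 => WithLp.toLp 2 fun j =>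
        m + √(ρ - m ^ 2) * (√N * inner ℝ (v j) (Ω : EuclideanSpace ℝ (Fin (N - 1)))) := by
      funext Ω
      ext j
      exact hΦj m Ω j
    rw [h]
    fun_prop
  have hint : ∀ m, Integrable (fun Ω => f (Φ m Ω)) σ := fun m =>
    (hf.continuous.comp (hΦc m)).integrable_toSphere
  set D := |√(ρ - m ^ 2) - √(ρ - m' ^ 2)| with hD
  -- An integrable majorant from |s| ≤ (1 + s²)/2 with s = √N⟨v, Ω⟩.
  set g : Metric.sphere (0 : EuclideanSpace ℝ (Fin (N - 1))) 1 → ℝ := fun Ω =>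
    ∑ j, (|m - m'| + D / 2 + D * N / 2 *
      (inner ℝ (v j) (Ω : EuclideanSpace ℝ (Fin (N - 1)))) ^ 2) with hg
  have hgc : Continuous g := by fun_prop
  have hbd : ∀ Ω, |f (Φ m Ω) - f (Φ m' Ω)| ≤ g Ω := by
    intro Ω
    have h1 := hf.dist_le_mul (Φ m Ω) (Φ m' Ω)
    rw [NNReal.coe_one, one_mul, Real.dist_eq, dist_eq_norm] at h1
    refine h1.trans ((EuclideanSpace.norm_le_sum_abs _).trans
      (Finset.sum_le_sum fun j _ => ?_))
    set t := inner ℝ (v j) (Ω : EuclideanSpace ℝ (Fin (N - 1))) with ht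
    have h2 : (Φ m Ω - Φ m' Ω) j = (m - m') + (√(ρ - m ^ 2) - √(ρ - m' ^ 2)) * (√N * t) := by
      rw [PiLp.sub_apply, hΦj, hΦj]
      ring
    rw [h2]
    refine (abs_add_le _ _).trans ?_
    rw [abs_mul, ← hD]
    have h3 : (√N * t) ^ 2 = N * t ^ 2 := by rw [mul_pow, Real.sq_sqrt (by linarith)]
    have h4 : |√N * t| ≤ (1 + N * t ^ 2) / 2 := by
      rw [← h3, ← sq_abs (√N * t)]
      linarith [sq_nonneg (|√N * t| - 1)]
    linarith [mul_le_mul_of_nonneg_left h4 (abs_nonneg _ : 0 ≤ D)]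
  have hgi : ∫ Ω, g Ω ∂σ ≤ n * (|m - m'| + 2 * D) * σ.real Set.univ := by
    have hi : ∀ j, Integrable (fun Ω : Metric.sphere (0 : EuclideanSpace ℝ (Fin (N - 1))) 1 =>
        (inner ℝ (v j) (Ω : EuclideanSpace ℝ (Fin (N - 1)))) ^ 2) σ := fun j =>
      Continuous.integrable_toSphere (by fun_prop)
    have hj : ∀ j, ∫ Ω, (|m - m'| + D / 2 + D * N / 2 * (inner ℝ (v j)
        (Ω : EuclideanSpace ℝ (Fin (N - 1)))) ^ 2) ∂σ ≤
        (|m - m'| + 2 * D) * σ.real Set.univ := by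
      intro j
      have hq := finrank_mul_integral_sq_inner_toSphere (v j)
      rw [finrank_euclideanSpace_fin, hd] at hq
      rw [integral_add (integrable_const _) ((hi j).const_mul _), integral_const_mul,
        integral_const, smul_eq_mul]
      set Q := ∫ Ω, (inner ℝ (v j) (Ω : EuclideanSpace ℝ (Fin (N - 1)))) ^ 2 ∂σ with hQ
      have hQ0 : 0 ≤ Q := integral_nonneg fun _ => sq_nonneg _
      -- The exact moment identity carries the dimension N - 1, and N ≤ 2(N - 1).
      have h1 : N * Q ≤ 2 * σ.real Set.univ := by
        have := mul_le_mul_of_nonneg_right (hv1 j) hσ0.le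
        nlinarith
      have h2 : D * (N * Q) ≤ D * (2 * σ.real Set.univ) :=
        mul_le_mul_of_nonneg_left h1 (abs_nonneg _)
      have h3 : 0 ≤ D * σ.real Set.univ := mul_nonneg (abs_nonneg _) hσ0.le
      linarith
    rw [hg, integral_finsetSum _ fun j _ => Continuous.integrable_toSphere (by fun_prop)]
    refine (Finset.sum_le_sum fun j _ => hj j).trans ?_
    simp [mul_assoc]
  have hdiff : |∫ Ω, f (Φ m Ω) ∂σ - ∫ Ω, f (Φ m' Ω) ∂σ| ≤ ∫ Ω, g Ω ∂σ := by
    rw [← integral_sub (hint m) (hint m')]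
    exact abs_integral_le_integral_abs.trans
      (integral_mono ((hint m).sub (hint m')).abs hgc.integrable_toSphere hbd)
  change |(σ.real Set.univ)⁻¹ * ∫ Ω, f (Φ m Ω) ∂σ - (σ.real Set.univ)⁻¹ * ∫ Ω, f (Φ m' Ω) ∂σ| ≤ _
  rw [← mul_sub, abs_mul, abs_of_pos (inv_pos.2 hσ0), inv_mul_le_iff₀ hσ0, mul_comm _ (_ * _)]
  exact hdiff.trans hgi

theorem continuous_magMicrocanonical {N n : ℕ} (hN : 2 ≤ N)
    {U : EuclideanSpace ℝ (Fin N) ≃ₗᵢ[ℝ] WithLp 2 (ℝ × EuclideanSpace ℝ (Fin (N - 1)))}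
    (hU : IsMagnetizationCoord U) (I : Finset (Fin N)) (hI : I.card = n)
    {f : EuclideanSpace ℝ (Fin n) → ℝ} (hf : LipschitzWith 1 f) (ρ : ℝ) :
    Continuous fun m => magMicrocanonical U m ρ (f ∘ coordProj I hI) := by
  refine continuous_iff_continuousAt.2 fun a => ?_
  rw [ContinuousAt, tendsto_iff_dist_tendsto_zero]
  refine squeeze_zero (fun _ => dist_nonneg)
    (fun m => magMicrocanonical_sub_le hN hU I hI hf ρ m a) ?_
  have h : Continuous fun m : ℝ =>
      n * (|m - a| + 2 * |√(ρ - m ^ 2) - √(ρ - a ^ 2)|) := by fun_prop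
  simpa using h.tendsto a

/-- Only a has to stay away from √ρ: after multiplying by the sum of the two roots, √(ρ - a²) alone
bounds that sum from below. -/
theorem abs_sqrt_sub_sq_sub_le {ρ m a : ℝ} (hm : m ^ 2 ≤ ρ) (ha : a ^ 2 < ρ) :
    |√(ρ - m ^ 2) - √(ρ - a ^ 2)| ≤ 2 * √ρ / √(ρ - a ^ 2) * |m - a| := by
  have hB : 0 < √(ρ - a ^ 2) := Real.sqrt_pos.2 (by linarith)
  rw [div_mul_eq_mul_div, le_div_iff₀ hB]
  have h1 : |√(ρ - m ^ 2) - √(ρ - a ^ 2)| * (√(ρ - m ^ 2) + √(ρ - a ^ 2)) =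
      |m + a| * |m - a| := by
    rw [← abs_of_nonneg (add_nonneg (Real.sqrt_nonneg (ρ - m ^ 2)) hB.le), ← abs_mul, ← abs_mul,
      ← abs_neg ((m + a) * (m - a))]
    congr 1
    nlinarith [Real.sq_sqrt (by linarith : 0 ≤ ρ - m ^ 2),
      Real.sq_sqrt (by linarith : 0 ≤ ρ - a ^ 2)]
  have h2 : |m + a| ≤ 2 * √ρ := by
    refine (abs_add_le _ _).trans ?_
    linarith [Real.abs_le_sqrt hm, Real.abs_le_sqrt ha.le]
  calc _ ≤ |√(ρ - m ^ 2) - √(ρ - a ^ 2)| * (√(ρ - m ^ 2) + √(ρ - a ^ 2)) :=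
        mul_le_mul_of_nonneg_left (by linarith [Real.sqrt_nonneg (ρ - m ^ 2)]) (abs_nonneg _)
    _ = _ := h1
    _ ≤ _ := mul_le_mul_of_nonneg_right h2 (abs_nonneg _)

/-! ### From energy to magnetization. -/

theorem microcanonical_neg_half_mul_sq {N : ℕ}
    (U : EuclideanSpace ℝ (Fin N) ≃ₗᵢ[ℝ] WithLp 2 (ℝ × EuclideanSpace ℝ (Fin (N - 1))))
    {J ρ m : ℝ} (hJ : 0 < J) (hm : 0 ≤ m) (hmρ : m ^ 2 < ρ)
    (f : EuclideanSpace ℝ (Fin N) → ℝ) :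
    microcanonical U J 0 (-(J * m ^ 2 / 2)) ρ f =
      1 / 2 * magMicrocanonical U m ρ f + 1 / 2 * magMicrocanonical U (-m) ρ f := by
  have h1 : (0 : ℝ) ^ 2 / J ^ 2 - 2 * -(J * m ^ 2 / 2) / J = m ^ 2 := by
    field_simp
    ring
  have hp : magPlus J 0 (-(J * m ^ 2 / 2)) = m := by
    rw [magPlus, h1, Real.sqrt_sq hm]
    simp
  have hn : magMinus J 0 (-(J * m ^ 2 / 2)) = -m := by
    rw [magMinus, h1, Real.sqrt_sq hm]
    simp
  rw [microcanonical]
  simp only [hp, hn, neg_sq]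
  -- At m = 0 the energy is critical and the definition uses its single-sector branch; the two
  -- halves coincide there.
  rcases hm.eq_or_lt with rfl | hm
  · have : 0 < ρ := by simpa using hmρ
    simp [this]
    ring
  have h2 : -(J * m ^ 2 / 2) < 0 ^ 2 / (2 * J) := by
    have : 0 < J * m ^ 2 / 2 := by positivity
    simpa using this
  rw [if_pos ⟨h2, hmρ, hmρ⟩]
  have h3 : magPartition N m ρ ≠ 0 := (Real.rpow_pos_of_pos (by linarith) _).ne'
  have h4 : magPartition N (-m) ρ = magPartition N m ρ := by simp [magPartition]
  rw [h4]
  congr 2 <;> field_simp <;> norm_num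

/-- The open interval avoids m = 0, where the energy partition function is singular, and m = √ρ,
where the ensemble takes its dummy value. The change of variables needs no integrability of F. -/
theorem integral_energy_eq_integral_magnetization {J ρ : ℝ} (hJ : 0 < J) (hρ : 0 < ρ)
    (F : ℝ → ℝ) :
    ∫ ε in (-(ρ * J / 2))..0, F ε =
      J * ∫ m in Set.Ioo 0 √ρ, m * F (-(J * m ^ 2 / 2)) := by
  have himg : (fun m : ℝ => -(J * m ^ 2 / 2)) '' Set.Ioo 0 √ρ = Set.Ioo (-(ρ * J / 2)) 0 := by
    ext ε
    constructor
    · rintro ⟨m, ⟨hm0, hm1⟩, rfl⟩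
      have h := (Real.lt_sqrt hm0.le).1 hm1
      constructor
      · have := mul_lt_mul_of_pos_left h hJ
        simp only
        linarith
      · have : 0 < J * m ^ 2 := by positivity
        simp only
        linarith
    · rintro ⟨h0, h1⟩
      have h2 : 0 < -(2 * ε / J) := by
        rw [← neg_div]
        exact div_pos (by linarith) hJ
      refine ⟨√(-(2 * ε / J)), ⟨Real.sqrt_pos.2 h2, Real.sqrt_lt_sqrt h2.le ?_⟩, ?_⟩
      · rw [← neg_div, div_lt_iff₀ hJ]
        linarith
      · simp only [Real.sq_sqrt h2.le]
        field_simp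
  have hinj : Set.InjOn (fun m : ℝ => -(J * m ^ 2 / 2)) (Set.Ioo 0 √ρ) := by
    intro x hx y hy hxy
    have h : J * x ^ 2 = J * y ^ 2 := by
      simp only at hxy
      linarith
    exact (pow_left_inj₀ hx.1.le hy.1.le two_ne_zero).1 (mul_left_cancel₀ hJ.ne' h)
  have hder : ∀ m ∈ Set.Ioo 0 √ρ,
      HasDerivWithinAt (fun m : ℝ => -(J * m ^ 2 / 2)) (-(J * m)) (Set.Ioo 0 √ρ) m := by
    intro m _
    refine HasDerivAt.hasDerivWithinAt ?_
    refine ((((hasDerivAt_id m).pow 2).const_mul J).div_const 2).neg.congr_deriv ?_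
    simp
    ring
  rw [intervalIntegral.integral_of_le (by nlinarith), integral_Ioc_eq_integral_Ioo, ← himg,
    integral_image_eq_integral_abs_deriv_smul measurableSet_Ioo hder hinj, ← integral_const_mul]
  refine setIntegral_congr_fun measurableSet_Ioo fun m hm => ?_
  simp only [abs_neg, abs_of_pos (mul_pos hJ hm.1), smul_eq_mul, mul_assoc]

/-- The Jacobian m cancels the singular factor 1/√(-2ε/J) = 1/m. -/
theorem exp_mul_energyPartition_eq {J ρ m : ℝ} (hJ : 0 < J) (hm : 0 < m) (β : ℝ) (N : ℕ) :
    m * (Real.exp (-(β * -(J * m ^ 2 / 2) * N)) * energyPartition N J (-(J * m ^ 2 / 2)) ρ) =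
      magWeight ρ (β * J * N / 2) (((N : ℝ) - 3) / 2) m := by
  have h1 : 2 * -(J * m ^ 2 / 2) / J = -m ^ 2 := by field_simp
  rw [energyPartition, h1, neg_neg, Real.sqrt_sq hm.le, magWeight, ← sub_eq_add_neg]
  have h2 : -(β * -(J * m ^ 2 / 2) * N) = β * J * N / 2 * m ^ 2 := by ring
  rw [h2]
  field_simp

/-- The canonical ensemble as a mixture of magnetization sectors. -/
theorem canonical_eq_integral_magWeight {N : ℕ}
    (U : EuclideanSpace ℝ (Fin N) ≃ₗᵢ[ℝ] WithLp 2 (ℝ × EuclideanSpace ℝ (Fin (N - 1))))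
    {J ρ : ℝ} (hJ : 0 < J) (hρ : 0 < ρ) (β : ℝ) (f : EuclideanSpace ℝ (Fin N) → ℝ) :
    canonical U J β ρ f =
      (∫ m in (0)..√ρ, magWeight ρ (β * J * N / 2) (((N : ℝ) - 3) / 2) m)⁻¹ *
        ∫ m in (0)..√ρ, magWeight ρ (β * J * N / 2) (((N : ℝ) - 3) / 2) m *
          (1 / 2 * magMicrocanonical U m ρ f + 1 / 2 * magMicrocanonical U (-m) ρ f) := by
  have hr : 0 ≤ √ρ := Real.sqrt_nonneg ρ
  rw [canonical, integral_energy_eq_integral_magnetization hJ hρ,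
    integral_energy_eq_integral_magnetization hJ hρ, mul_inv, mul_mul_mul_comm,
    inv_mul_cancel₀ hJ.ne', one_mul, intervalIntegral.integral_of_le hr,
    intervalIntegral.integral_of_le hr, integral_Ioc_eq_integral_Ioo,
    integral_Ioc_eq_integral_Ioo]
  congr 1
  · exact congrArg _ (setIntegral_congr_fun measurableSet_Ioo fun m hm =>
      exp_mul_energyPartition_eq hJ hm.1 β N)
  · refine setIntegral_congr_fun measurableSet_Ioo fun m hm => ?_
    rw [← mul_assoc, exp_mul_energyPartition_eq hJ hm.1 β N,
      microcanonical_neg_half_mul_sq U hJ hm.1.le ((Real.lt_sqrt hm.1.le).1 hm.2)]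

/-! ### From concentration to equivalence of ensembles. -/

/-- A weighted mean of a function that is Lipschitz around `a` is close to its value at `a` if
the weight has second moment of order `1 / N` around `a`. -/
theorem abs_sub_weighted_mean_le {w G : ℝ → ℝ} {r a L K N : ℝ} (hr : 0 ≤ r) (hN : 0 < N)
    (hL : 0 ≤ L) (hw : Continuous w) (hG : Continuous G) (hw0 : ∀ m ∈ Set.Icc 0 r, 0 ≤ w m)
    (hZ : 0 < ∫ m in (0)..r, w m) (hGL : ∀ m ∈ Set.Icc 0 r, |G m - G a| ≤ L * |m - a|)
    (hK : ∫ m in (0)..r, w m * (N * (m - a) ^ 2) ≤ K * ∫ m in (0)..r, w m) :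
    |G a - (∫ m in (0)..r, w m)⁻¹ * ∫ m in (0)..r, w m * G m| ≤
      L * ((1 + K) / 2) * N ^ (-(1 / 2) : ℝ) := by
  set Z := ∫ m in (0)..r, w m with hZdef
  have hs : 0 < √N := Real.sqrt_pos.2 hN
  have h1 : G a - Z⁻¹ * ∫ m in (0)..r, w m * G m =
      Z⁻¹ * ∫ m in (0)..r, w m * (G a - G m) := by
    simp only [mul_sub]
    rw [intervalIntegral.integral_sub (Continuous.intervalIntegrable (by fun_prop) _ _)
      (Continuous.intervalIntegrable (by fun_prop) _ _), intervalIntegral.integral_mul_const,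
      ← hZdef, mul_sub, inv_mul_cancel_left₀ hZ.ne']
  have h2 : |∫ m in (0)..r, w m * (G a - G m)| ≤
      ∫ m in (0)..r, L / (2 * √N) * (w m + w m * (N * (m - a) ^ 2)) := by
    refine (intervalIntegral.abs_integral_le_integral_abs hr).trans
      (intervalIntegral.integral_mono_on hr (Continuous.intervalIntegrable (by fun_prop) _ _)
      (Continuous.intervalIntegrable (by fun_prop) _ _) fun m hm => ?_)
    rw [abs_mul, abs_of_nonneg (hw0 m hm), abs_sub_comm]
    -- The inequality 2s ≤ 1 + s² at s = √N|m - a|; this produces the rate N^(-1/2).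
    have h3 : |m - a| ≤ 1 / (2 * √N) * (1 + N * (m - a) ^ 2) := by
      rw [one_div, ← div_eq_inv_mul, le_div_iff₀ (by positivity), ← sq_abs (m - a)]
      nlinarith [sq_nonneg (√N * |m - a| - 1), Real.sq_sqrt hN.le]
    calc w m * |G m - G a| ≤ w m * (L * (1 / (2 * √N) * (1 + N * (m - a) ^ 2))) :=
          mul_le_mul_of_nonneg_left ((hGL m hm).trans (mul_le_mul_of_nonneg_left h3 hL))
            (hw0 m hm)
      _ = _ := by ring
  rw [intervalIntegral.integral_const_mul, intervalIntegral.integral_add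
    (Continuous.intervalIntegrable (by fun_prop) _ _)
    (Continuous.intervalIntegrable (by fun_prop) _ _), ← hZdef] at h2
  have h4 : N ^ (-(1 / 2) : ℝ) = 1 / √N := by
    rw [Real.rpow_neg hN.le, ← Real.sqrt_eq_rpow, one_div]
  rw [h1, abs_mul, abs_of_pos (inv_pos.2 hZ), inv_mul_le_iff₀ hZ, h4]
  refine h2.trans ((mul_le_mul_of_nonneg_left (add_le_add_right hK Z)
    (by positivity)).trans_eq ?_)
  field_simp

/-- Ensemble equivalence in the energy shell of magnetization `±a`, given the concentration of
the modulus of the magnetization at `a` in the canonical ensemble. -/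
theorem abs_microcanonical_sub_canonical_le {J ρ a β K : ℝ} (hJ : 0 < J) (hρ : 0 < ρ)
    (ha0 : 0 ≤ a) (ha : a ^ 2 < ρ) {N n : ℕ} (hN : 3 ≤ N)
    {U : EuclideanSpace ℝ (Fin N) ≃ₗᵢ[ℝ] WithLp 2 (ℝ × EuclideanSpace ℝ (Fin (N - 1)))}
    (hU : IsMagnetizationCoord U) (I : Finset (Fin N)) (hI : I.card = n)
    {f : EuclideanSpace ℝ (Fin n) → ℝ} (hf : LipschitzWith 1 f)
    (hK : ∫ m in (0)..√ρ, magWeight ρ (β * J * N / 2) (((N : ℝ) - 3) / 2) m * (N * (m - a) ^ 2) ≤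
      K * ∫ m in (0)..√ρ, magWeight ρ (β * J * N / 2) (((N : ℝ) - 3) / 2) m) :
    |microcanonical U J 0 (-(J * a ^ 2 / 2)) ρ (f ∘ coordProj I hI) -
        canonical U J β ρ (f ∘ coordProj I hI)| ≤
      n * (1 + 2 * (2 * √ρ / √(ρ - a ^ 2))) * ((1 + K) / 2) * (N : ℝ) ^ (-(1 / 2) : ℝ) := by
  have hN' : (3 : ℝ) ≤ N := by exact_mod_cast hN
  have hp : 0 ≤ ((N : ℝ) - 3) / 2 := by linarith
  rw [microcanonical_neg_half_mul_sq U hJ ha0 ha, canonical_eq_integral_magWeight U hJ hρ]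
  have hg := continuous_magMicrocanonical (by omega) hU I hI hf ρ
  have hg' : Continuous fun m => magMicrocanonical U (-m) ρ (f ∘ coordProj I hI) :=
    hg.comp continuous_neg
  refine abs_sub_weighted_mean_le (G := fun m =>
    1 / 2 * magMicrocanonical U m ρ (f ∘ coordProj I hI) +
      1 / 2 * magMicrocanonical U (-m) ρ (f ∘ coordProj I hI)) (Real.sqrt_nonneg ρ)
    (by linarith) (by positivity) (continuous_magWeight ρ _ hp) (by fun_prop)
    (fun m hm => magWeight_nonneg hρ.le _ _ hm) (integral_magWeight_pos hρ _ hp)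
    (fun m hm => ?_) hK
  have hs := abs_sqrt_sub_sq_sub_le (sq_le_of_mem_Icc_sqrt hρ.le hm) ha
  have h1 := magMicrocanonical_sub_le (by omega) hU I hI hf ρ m a
  have h2 := magMicrocanonical_sub_le (by omega) hU I hI hf ρ (-m) (-a)
  rw [neg_sq, neg_sq, neg_sub_neg, abs_sub_comm a m] at h2
  have h3 : (n : ℝ) * (|m - a| + 2 * |√(ρ - m ^ 2) - √(ρ - a ^ 2)|) ≤
      n * (|m - a| + 2 * (2 * √ρ / √(ρ - a ^ 2) * |m - a|)) := by gcongr
  rw [abs_le] at h1 h2 ⊢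
  constructor <;> linarith [h1.1, h1.2, h2.1, h2.2]

theorem mainTheorem11 (J ρ : ℝ) (hJ : 0 < J) (hρ : 0 < ρ) (n : ℕ) :
    (∀ ε ∈ Set.Ioo (-(J * ρ / 2)) 0, ∃ C : ℝ, ∃ N₀ : ℕ, ∀ N : ℕ, N₀ ≤ N →
      ∀ U : EuclideanSpace ℝ (Fin N) ≃ₗᵢ[ℝ] WithLp 2 (ℝ × EuclideanSpace ℝ (Fin (N - 1))),
      IsMagnetizationCoord U →
      ∀ (I : Finset (Fin N)) (hI : I.card = n) (f : EuclideanSpace ℝ (Fin n) → ℝ),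
      LipschitzWith 1 f → (∃ B : ℝ, ∀ x, |f x| ≤ B) →
      |microcanonical U J 0 ε ρ (f ∘ coordProj I hI) -
          canonical U J ((1 / J) / (ρ + 2 * ε / J)) ρ (f ∘ coordProj I hI)|
        ≤ C * (N : ℝ) ^ (-(1 / 2) : ℝ)) ∧
    (∀ β : ℝ, β < 1 / (ρ * J) → ∃ C : ℝ, ∃ N₀ : ℕ, ∀ N : ℕ, N₀ ≤ N →
      ∀ U : EuclideanSpace ℝ (Fin N) ≃ₗᵢ[ℝ] WithLp 2 (ℝ × EuclideanSpace ℝ (Fin (N - 1))),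
      IsMagnetizationCoord U →
      ∀ (I : Finset (Fin N)) (hI : I.card = n) (f : EuclideanSpace ℝ (Fin n) → ℝ),
      LipschitzWith 1 f → (∃ B : ℝ, ∀ x, |f x| ≤ B) →
      |microcanonical U J 0 0 ρ (f ∘ coordProj I hI) -
          canonical U J β ρ (f ∘ coordProj I hI)|
        ≤ C * (N : ℝ) ^ (-(1 / 2) : ℝ)) := by
  constructor
  · rintro ε ⟨hε0, hε1⟩
    have hpos : 0 < -(2 * ε / J) := by
      rw [← neg_div]
      exact div_pos (by linarith) hJ
    obtain ⟨a, ha0, rfl⟩ : ∃ a : ℝ, 0 < a ∧ ε = -(J * a ^ 2 / 2) := by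
      refine ⟨√(-(2 * ε / J)), Real.sqrt_pos.2 hpos, ?_⟩
      rw [Real.sq_sqrt hpos.le]
      field_simp
    have ha : a ^ 2 < ρ := lt_of_mul_lt_mul_left (by linarith) hJ.le
    have hu : ρ + 2 * -(J * a ^ 2 / 2) / J = ρ - a ^ 2 := by
      field_simp
      ring
    have hβ : 1 / J / (ρ - a ^ 2) * J = 1 / (ρ - a ^ 2) := by field_simp
    rw [hu]
    -- The threshold 3 makes the exponent (N - 3)/2 nonnegative, hence the weight continuous up to
    -- √ρ.
    refine ⟨n * (1 + 2 * (2 * √ρ / √(ρ - a ^ 2))) *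
      ((1 + 16 / a * (ρ * (ρ - a ^ 2) / a)) / 2), 3, fun N hN U hU I hI f hf _ => ?_⟩
    refine abs_microcanonical_sub_canonical_le hJ hρ ha0.le ha hN hU I hI hf ?_
    rw [hβ]
    exact integral_magWeight_mul_sq_le_ordered hρ ha0 ha (by exact_mod_cast hN)
  · intro β hβ
    have hβ' : β * J * ρ < 1 := by
      rw [lt_div_iff₀ (by positivity)] at hβ
      linarith
    refine ⟨n * (1 + 2 * (2 * √ρ / √(ρ - 0 ^ 2))) *
      ((1 + 2 * ρ / (1 - max (β * J * ρ) 0)) / 2), 3, fun N hN U hU I hI f hf _ => ?_⟩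
    have h := abs_microcanonical_sub_canonical_le (β := β) hJ hρ le_rfl (by simpa using hρ) hN hU
      I hI hf (K := 2 * ρ / (1 - max (β * J * ρ) 0)) (by
        simpa only [sub_zero] using
          integral_magWeight_mul_sq_le_disordered hρ hβ' (N := N) (by exact_mod_cast hN))
    simpa using h
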